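/- Let $2<p\le 4$. For a real $2$-homogeneous polynomial $P(x,y)=ax^2+by^2+cxy$ in two variables let $\|P\|=\sup\{|P(x,y)| : |x|^p+|y|^p\le 1\}$ be its norm as a polynomial on $\ell_p(\mathbb{R}^2)$, and for $q\ge 1$ let $|P|_q=\left(|a|^q+|b|^q+|c|^q\right)^{1/q}$. Then the optimal Hardy--Littlewood constant for real $2$-homogeneous polynomials on $\ell_p(\mathbb{R}^2)$, i.e. the least real number $C$ such that $$|P|_{\frac{p}{p-2}}=\left(|a|^{\frac{p}{p-2}}+|b|^{\frac{p}{p-2}}+|c|^{\frac{p}{p-2}}\right)^{\frac{p-2}{p}}\le C\,\|P\|$$ for all such $P$, is exactly $2^{2/p}$. More generally, for every real $q\ge 2$, the least real number $C$ such that $|P|_q\le C\,\|P\|$ for all such $P$ is also exactly $2^{2/p}$. -/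

import Mathlib

noncomputable section

/-- The sup norm `‖P‖` of a real polynomial in `n` variables over the closed unit ball of
`ℓ_p(ℝⁿ)`. -/
def polyNorm {n : ℕ} (p : ℝ) (P : MvPolynomial (Fin n) ℝ) : ℝ :=
  ⨆ x : {x : PiLp (ENNReal.ofReal p) (fun _ : Fin n => ℝ) // ‖x‖ ≤ 1},
    |MvPolynomial.eval (fun i => x.1 i) P|

/-- The coefficient norm `|P|_q = (∑_{|α| = 2} |a_α|^q)^{1/q}` of a `2`-homogeneous
polynomial, the sum running over all multi-indices `α ∈ ℕⁿ` with `α₁ + ⋯ + αₙ = 2`. -/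
def coeffNorm {n : ℕ} (q : ℝ) (P : MvPolynomial (Fin n) ℝ) : ℝ :=
  (∑ α ∈ Finset.finsuppAntidiag (Finset.univ : Finset (Fin n)) 2,
    |MvPolynomial.coeff α P| ^ q) ^ (1 / q)

/-- `C` is the optimal constant in `|P|_q ≤ C ‖P‖` for real `2`-homogeneous polynomials on
`ℓ_p(ℝⁿ)`: the least real number for which the inequality holds for all of them. -/
def IsOptimalHLConstant (n : ℕ) (p q C : ℝ) : Prop :=
  IsLeast {K : ℝ | ∀ P : MvPolynomial (Fin n) ℝ, P.IsHomogeneous 2 →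
    coeffNorm q P ≤ K * polyNorm p P} C

end

/-! For the upper bound it suffices to take `q = 2`, since `ℓ_q` norms decrease in `q`. As `p ≤ 4`,
comparing `ℓ_p` with `ℓ_4` turns the norm into the homogeneous bound `2 P(x, y)² ≤ N (x⁴ + y⁴)` with
`N = (2^(2/p) ‖P‖)²` (`two_mul_sq_eval_le`). Well-chosen points then give `a² + b² + c² ≤ N`: `(1,
±1)` when `ab ≥ 0`, a complex square root when `ab < 0` (`sum_sq_le_of_form_le`). The form `xy`
shows sharpness for every `q`. -/

open Finset in
/-- The multi-indices of degree `2` in two variables. -/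
theorem finsuppAntidiag_fin_two_two :
    finsuppAntidiag (univ : Finset (Fin 2)) 2 =
      {Finsupp.single 0 2, Finsupp.single 1 2, Finsupp.single 0 1 + Finsupp.single 1 1} := by
  ext α
  have key : ∀ β : Fin 2 →₀ ℕ, α = β ↔ α 0 = β 0 ∧ α 1 = β 1 := fun β => by
    rw [DFunLike.ext_iff, Fin.forall_fin_two]
  simp only [mem_finsuppAntidiag, Fin.sum_univ_two, mem_insert, mem_singleton, key]
  simp
  omega

theorem sum_finsuppAntidiag_fin_two_two (f : (Fin 2 →₀ ℕ) → ℝ) :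
    ∑ α ∈ Finset.finsuppAntidiag (Finset.univ : Finset (Fin 2)) 2, f α =
      f (Finsupp.single 0 2) + f (Finsupp.single 1 2) +
        f (Finsupp.single 0 1 + Finsupp.single 1 1) := by
  have h₁ : (Finsupp.single 0 2 : Fin 2 →₀ ℕ) ≠ Finsupp.single 1 2 := fun h => by
    simpa using DFunLike.congr_fun h 0
  have h₂ : (Finsupp.single 0 2 : Fin 2 →₀ ℕ) ≠ Finsupp.single 0 1 + Finsupp.single 1 1 :=
    fun h => by simpa using DFunLike.congr_fun h 1
  have h₃ : (Finsupp.single 1 2 : Fin 2 →₀ ℕ) ≠ Finsupp.single 0 1 + Finsupp.single 1 1 :=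
    fun h => by simpa using DFunLike.congr_fun h 0
  rw [finsuppAntidiag_fin_two_two, Finset.sum_insert (by simp [h₁, h₂]),
    Finset.sum_insert (by simp [h₃]), Finset.sum_singleton, add_assoc]

theorem eval_eq_of_isHomogeneous_two {P : MvPolynomial (Fin 2) ℝ} (hP : P.IsHomogeneous 2)
    (x : Fin 2 → ℝ) :
    MvPolynomial.eval x P = P.coeff (Finsupp.single 0 2) * x 0 ^ 2 +
      P.coeff (Finsupp.single 1 2) * x 1 ^ 2 +
      P.coeff (Finsupp.single 0 1 + Finsupp.single 1 1) * (x 0 * x 1) := by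
  have hsub : P.support ⊆ Finset.finsuppAntidiag (Finset.univ : Finset (Fin 2)) 2 := by
    intro α hα
    have := hP (MvPolynomial.mem_support_iff.1 hα)
    rw [Finsupp.weight_apply, Finsupp.sum_fintype _ _ (by simp)] at this
    simpa [Finset.mem_finsuppAntidiag] using this
  rw [MvPolynomial.eval_eq', Finset.sum_subset hsub, sum_finsuppAntidiag_fin_two_two]
  · simp [Fin.prod_univ_two]
  · intro α _ hα
    rw [MvPolynomial.notMem_support_iff.1 hα, zero_mul]

theorem norm_piLp_fin_two_le_one_iff {p : ℝ} (hp : 0 < p)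
    (x : PiLp (ENNReal.ofReal p) (fun _ : Fin 2 => ℝ)) :
    ‖x‖ ≤ 1 ↔ |x 0| ^ p + |x 1| ^ p ≤ 1 := by
  have h : 0 < (ENNReal.ofReal p).toReal := by rwa [ENNReal.toReal_ofReal hp.le]
  rw [PiLp.norm_eq_sum h, ENNReal.toReal_ofReal hp.le, Fin.sum_univ_two]
  simp only [Real.norm_eq_abs]
  have hs : 0 ≤ |x 0| ^ p + |x 1| ^ p := by positivity
  rw [← Real.rpow_le_rpow_iff (z := p) (Real.rpow_nonneg hs _) zero_le_one hp, Real.one_rpow,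
    ← Real.rpow_mul hs, one_div_mul_cancel hp.ne', Real.rpow_one]

theorem abs_le_one_of_rpow_add_le_one {p s t : ℝ} (hp : 0 < p) (h : |s| ^ p + |t| ^ p ≤ 1) :
    |s| ≤ 1 ∧ |t| ≤ 1 := by
  have hs := Real.rpow_nonneg (abs_nonneg s) p
  have ht := Real.rpow_nonneg (abs_nonneg t) p
  constructor <;> by_contra! hc
  · linarith [Real.one_lt_rpow hc hp]
  · linarith [Real.one_lt_rpow hc hp]

theorem polyNorm_nonneg {n : ℕ} (p : ℝ) (P : MvPolynomial (Fin n) ℝ) : 0 ≤ polyNorm p P :=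
  Real.iSup_nonneg fun _ => abs_nonneg _

/-- The norm of a quadratic form bounds its values on the unit ball of `ℓ_p`. -/
theorem abs_eval_le_polyNorm {p : ℝ} (hp : 0 < p) {P : MvPolynomial (Fin 2) ℝ}
    (hP : P.IsHomogeneous 2) {x : Fin 2 → ℝ} (hx : |x 0| ^ p + |x 1| ^ p ≤ 1) :
    |MvPolynomial.eval x P| ≤ polyNorm p P := by
  -- A real `⨆` of an unbounded family is `0`, so boundedness must be established.
  have hbdd : BddAbove (Set.range fun x : {x : PiLp (ENNReal.ofReal p) (fun _ : Fin 2 => ℝ) //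
      ‖x‖ ≤ 1} => |MvPolynomial.eval (fun i => x.1 i) P|) := by
    refine ⟨|P.coeff (Finsupp.single 0 2)| + |P.coeff (Finsupp.single 1 2)| +
      |P.coeff (Finsupp.single 0 1 + Finsupp.single 1 1)|, ?_⟩
    rintro _ ⟨⟨y, hy⟩, rfl⟩
    obtain ⟨h0, h1⟩ :=
      abs_le_one_of_rpow_add_le_one hp ((norm_piLp_fin_two_le_one_iff hp y).1 hy)
    simp only [eval_eq_of_isHomogeneous_two hP]
    refine (abs_add_three _ _ _).trans ?_
    rw [abs_mul, abs_mul, abs_mul, abs_mul (y 0), abs_pow, abs_pow]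
    gcongr
    · exact mul_le_of_le_one_right (abs_nonneg _) (pow_le_one₀ (abs_nonneg _) h0)
    · exact mul_le_of_le_one_right (abs_nonneg _) (pow_le_one₀ (abs_nonneg _) h1)
    · exact mul_le_of_le_one_right (abs_nonneg _) (mul_le_one₀ h0 (abs_nonneg _) h1)
  exact le_ciSup hbdd ⟨WithLp.toLp _ x, (norm_piLp_fin_two_le_one_iff hp _).2 hx⟩

/-- The comparison `‖(s, t)‖_p ≤ 2 ^ (1/p - 1/4) ‖(s, t)‖_4`, raised to the power `p`. -/
theorem rpow_add_rpow_le_of_le_four {p : ℝ} (hp₀ : 0 < p) (hp₄ : p ≤ 4) (s t : ℝ) :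
    |s| ^ p + |t| ^ p ≤ 2 * ((s ^ 4 + t ^ 4) / 2) ^ (p / 4) := by
  have hpow : ∀ u : ℝ, (u ^ 4) ^ (p / 4) = |u| ^ p := fun u => by
    rw [← Even.pow_abs (by decide : Even 4) u, ← Real.rpow_natCast, ← Real.rpow_mul (abs_nonneg u)]
    congr 1
    push_cast
    ring
  -- Concavity of `u ↦ u^(p/4)` at the midpoint; this is where `p ≤ 4` enters.
  have h := (Real.concaveOn_rpow (p := p / 4) (by positivity) (by linarith)).2
    (Set.mem_Ici.2 (by positivity : 0 ≤ s ^ 4)) (Set.mem_Ici.2 (by positivity : 0 ≤ t ^ 4))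
    (by norm_num : (0 : ℝ) ≤ 1 / 2) (by norm_num : (0 : ℝ) ≤ 1 / 2) (by norm_num)
  simp only [smul_eq_mul, hpow] at h
  rw [show (s ^ 4 + t ^ 4) / 2 = 1 / 2 * s ^ 4 + 1 / 2 * t ^ 4 by ring]
  linarith

/-- On `ℓ_p` with `p ≤ 4`, a quadratic form is controlled by its norm and the `ℓ_4` norm. -/
theorem two_mul_sq_eval_le {p : ℝ} (hp₀ : 0 < p) (hp₄ : p ≤ 4) {P : MvPolynomial (Fin 2) ℝ}
    (hP : P.IsHomogeneous 2) (x : Fin 2 → ℝ) :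
    2 * (MvPolynomial.eval x P) ^ 2 ≤
      ((2 : ℝ) ^ (2 / p) * polyNorm p P) ^ 2 * (x 0 ^ 4 + x 1 ^ 4) := by
  by_cases hx : x 0 = 0 ∧ x 1 = 0
  · rw [eval_eq_of_isHomogeneous_two hP, hx.1, hx.2]
    simp
  set m : ℝ := (x 0 ^ 4 + x 1 ^ 4) / 2 with hm
  have hm_pos : 0 < m := by
    rw [not_and_or] at hx
    rcases hx with h | h <;> positivity
  -- `r` is the upper bound for `‖x‖_p` given by the `ℓ_4` comparison, so `x / r` lies in the unit
  -- ball.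
  set r : ℝ := (2 : ℝ) ^ (1 / p) * m ^ (1 / 4 : ℝ) with hr
  have hr_pos : 0 < r := by positivity
  have hrp : r ^ p = 2 * m ^ (p / 4) := by
    rw [hr, Real.mul_rpow (by positivity) (by positivity), ← Real.rpow_mul (by norm_num),
      ← Real.rpow_mul hm_pos.le, one_div_mul_cancel hp₀.ne', Real.rpow_one]
    congr 2
    ring
  have hr4 : r ^ 4 = ((2 : ℝ) ^ (2 / p)) ^ 2 * m := by
    rw [hr, mul_pow, ← Real.rpow_mul_natCast (by norm_num), ← Real.rpow_mul_natCast hm_pos.le,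
      ← Real.rpow_mul_natCast (by norm_num)]
    norm_num
    left
    congr 1
    ring
  have hball : |x 0 / r| ^ p + |x 1 / r| ^ p ≤ 1 := by
    rw [abs_div, abs_div, abs_of_pos hr_pos, Real.div_rpow (abs_nonneg _) hr_pos.le,
      Real.div_rpow (abs_nonneg _) hr_pos.le, ← add_div, div_le_one (by positivity), hrp]
    exact rpow_add_rpow_le_of_le_four hp₀ hp₄ _ _
  have hle := abs_eval_le_polyNorm hp₀ hP (x := fun i => x i / r) hball
  have heval : MvPolynomial.eval (fun i => x i / r) P * r ^ 2 = MvPolynomial.eval x P := by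
    simp only [eval_eq_of_isHomogeneous_two hP]
    field_simp
  have hsq : MvPolynomial.eval (fun i => x i / r) P ^ 2 ≤ polyNorm p P ^ 2 := by
    rw [← sq_abs]
    exact pow_le_pow_left₀ (abs_nonneg _) hle 2
  calc 2 * (MvPolynomial.eval x P) ^ 2
      = 2 * (MvPolynomial.eval (fun i => x i / r) P ^ 2 * r ^ 4) := by rw [← heval]; ring
    _ ≤ 2 * (polyNorm p P ^ 2 * r ^ 4) := by gcongr
    _ = _ := by rw [hr4, hm]; ring

/-- If `a` is the dominant diagonal coefficient and `b` has the opposite sign, evaluating the form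
at a complex square root of `a + ci` gives the bound. -/
theorem sum_sq_le_of_dominant {a b c N : ℝ} (hb : b ≤ 0) (hab : -b ≤ a)
    (h : ∀ x y : ℝ, 2 * (a * x ^ 2 + b * y ^ 2 + c * (x * y)) ^ 2 ≤ N * (x ^ 4 + y ^ 4)) :
    a ^ 2 + b ^ 2 + c ^ 2 ≤ N := by
  obtain ⟨z, hz⟩ := IsAlgClosed.exists_pow_nat_eq (⟨a, c⟩ : ℂ) (n := 2) (by norm_num)
  have hre : z.re ^ 2 - z.im ^ 2 = a := by
    have := congrArg Complex.re hz
    rw [pow_two, Complex.mul_re] at this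
    linarith
  have him : 2 * (z.re * z.im) = c := by
    have := congrArg Complex.im hz
    rw [pow_two, Complex.mul_im] at this
    linarith
  set M : ℝ := a ^ 2 + c ^ 2 / 2 with hM
  have hM_le : M ≤ a * z.re ^ 2 + b * z.im ^ 2 + c * (z.re * z.im) := by
    -- Replacing `b` by `-a` only lowers the form, and the lowered value is exactly `M`.
    have : 0 ≤ (a + b) * z.im ^ 2 := mul_nonneg (by linarith) (sq_nonneg _)
    have h₁ : c * (z.re * z.im) = c ^ 2 / 2 := by rw [← him]; ring
    have h₂ : a * z.re ^ 2 = a ^ 2 + a * z.im ^ 2 := by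
      rw [show z.re ^ 2 = a + z.im ^ 2 by linarith]; ring
    linarith
  have hquartic : z.re ^ 4 + z.im ^ 4 = M := by rw [hM, ← hre, ← him]; ring
  have hM₀ : 0 ≤ M := by positivity
  have hbound := h z.re z.im
  rw [hquartic] at hbound
  have hba : b ^ 2 ≤ a ^ 2 := by nlinarith
  have hNM : 2 * M ^ 2 ≤ N * M :=
    (mul_le_mul_of_nonneg_left (pow_le_pow_left₀ hM₀ hM_le 2) (by norm_num)).trans hbound
  -- If `M = 0` then `a = b = c = 0`. Otherwise cancelling `M` gives `2a² + c² ≤ N`, and `b² ≤ a²`.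
  rcases hM₀.eq_or_lt with hzero | hpos
  · have hN := h 1 0
    nlinarith [sq_nonneg a, sq_nonneg c]
  · have : 2 * M ≤ N := le_of_mul_le_mul_right (by linarith) hpos
    linarith

/-- If `ab ≥ 0`, the better of `(1, ±1)` gives `(|a + b| + |c|)² ≤ N`, which dominates the sum of
squares. If `ab < 0`, swapping variables and changing sign reduce to the dominant case. -/
theorem sum_sq_le_of_form_le {a b c N : ℝ}
    (h : ∀ x y : ℝ, 2 * (a * x ^ 2 + b * y ^ 2 + c * (x * y)) ^ 2 ≤ N * (x ^ 4 + y ^ 4)) :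
    a ^ 2 + b ^ 2 + c ^ 2 ≤ N := by
  rcases le_or_gt 0 (a * b) with hab | hab
  · have h₁ := h 1 1
    have h₂ := h 1 (-1)
    rcases le_total 0 ((a + b) * c) with hc | hc <;> nlinarith
  · have hneg : ∀ x y : ℝ,
        2 * (-a * x ^ 2 + -b * y ^ 2 + -c * (x * y)) ^ 2 ≤ N * (x ^ 4 + y ^ 4) := fun x y => by
      linarith [h x y]
    have hswap : ∀ x y : ℝ,
        2 * (b * x ^ 2 + a * y ^ 2 + c * (x * y)) ^ 2 ≤ N * (x ^ 4 + y ^ 4) := fun x y => by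
      linarith [h y x]
    have hswap_neg : ∀ x y : ℝ,
        2 * (-b * x ^ 2 + -a * y ^ 2 + -c * (x * y)) ^ 2 ≤ N * (x ^ 4 + y ^ 4) := fun x y => by
      linarith [h y x]
    rcases mul_neg_iff.1 hab with ⟨ha, hb⟩ | ⟨ha, hb⟩ <;> rcases le_total 0 (a + b) with hs | hs
    · exact sum_sq_le_of_dominant hb.le (by linarith) h
    · linarith [sum_sq_le_of_dominant (by linarith) (by linarith) hswap_neg]
    · linarith [sum_sq_le_of_dominant ha.le (by linarith) hswap]
    · linarith [sum_sq_le_of_dominant (by linarith) (by linarith) hneg]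

theorem rpow_le_sq_mul_rpow {q t N : ℝ} (hq : 2 ≤ q) (ht : 0 ≤ t) (htN : t ≤ N) :
    t ^ q ≤ t ^ 2 * N ^ (q - 2) := by
  have : t ^ q = t ^ 2 * t ^ (q - 2) := by
    rw [← Real.rpow_two, ← Real.rpow_add_of_nonneg ht (by norm_num) (by linarith)]
    ring_nf
  rw [this]
  gcongr

/-- The `ℓ_q` norm is at most the `ℓ_2` norm when `q ≥ 2`. -/
theorem coeffNorm_le_of_sum_sq_le {P : MvPolynomial (Fin 2) ℝ} {q N : ℝ} (hq : 2 ≤ q) (hN : 0 ≤ N)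
    (h : P.coeff (Finsupp.single 0 2) ^ 2 + P.coeff (Finsupp.single 1 2) ^ 2 +
      P.coeff (Finsupp.single 0 1 + Finsupp.single 1 1) ^ 2 ≤ N ^ 2) :
    coeffNorm q P ≤ N := by
  have hq₀ : 0 < q := by linarith
  rw [coeffNorm, sum_finsuppAntidiag_fin_two_two]
  set a := P.coeff (Finsupp.single 0 2)
  set b := P.coeff (Finsupp.single 1 2)
  set c := P.coeff (Finsupp.single 0 1 + Finsupp.single 1 1)
  have ha := rpow_le_sq_mul_rpow hq (abs_nonneg a) (abs_le_of_sq_le_sq (by nlinarith) hN)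
  have hb := rpow_le_sq_mul_rpow hq (abs_nonneg b) (abs_le_of_sq_le_sq (by nlinarith) hN)
  have hc := rpow_le_sq_mul_rpow hq (abs_nonneg c) (abs_le_of_sq_le_sq (by nlinarith) hN)
  rw [sq_abs] at ha hb hc
  have hNq : N ^ q = N ^ 2 * N ^ (q - 2) := by
    rw [← Real.rpow_two, ← Real.rpow_add_of_nonneg hN (by norm_num) (by linarith)]
    ring_nf
  have hsum : |a| ^ q + |b| ^ q + |c| ^ q ≤ N ^ q := by
    rw [hNq]
    have := mul_le_mul_of_nonneg_right h (Real.rpow_nonneg hN (q - 2))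
    linarith
  calc (|a| ^ q + |b| ^ q + |c| ^ q) ^ (1 / q) ≤ (N ^ q) ^ (1 / q) := by gcongr
    _ = N := by rw [← Real.rpow_mul hN, mul_one_div_cancel hq₀.ne', Real.rpow_one]

theorem coeff_X_zero_mul_X_one (α : Fin 2 →₀ ℕ) :
    MvPolynomial.coeff α (MvPolynomial.X 0 * MvPolynomial.X 1 : MvPolynomial (Fin 2) ℝ) =
      if Finsupp.single 0 1 + Finsupp.single 1 1 = α then 1 else 0 := by
  rw [MvPolynomial.X, MvPolynomial.X, MvPolynomial.monomial_mul, MvPolynomial.coeff_monomial,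
    mul_one]

theorem coeffNorm_X_zero_mul_X_one {q : ℝ} (hq : 0 < q) :
    coeffNorm q (MvPolynomial.X 0 * MvPolynomial.X 1 : MvPolynomial (Fin 2) ℝ) = 1 := by
  have h₁ : Finsupp.single 0 1 + Finsupp.single 1 1 ≠ (Finsupp.single 0 2 : Fin 2 →₀ ℕ) :=
    fun h => by simpa using DFunLike.congr_fun h 1
  have h₂ : Finsupp.single 0 1 + Finsupp.single 1 1 ≠ (Finsupp.single 1 2 : Fin 2 →₀ ℕ) :=
    fun h => by simpa using DFunLike.congr_fun h 0
  rw [coeffNorm, sum_finsuppAntidiag_fin_two_two]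
  simp [coeff_X_zero_mul_X_one, h₁, h₂, Real.zero_rpow hq.ne']

theorem polyNorm_X_zero_mul_X_one_le {p : ℝ} (hp : 0 < p) :
    polyNorm p (MvPolynomial.X 0 * MvPolynomial.X 1 : MvPolynomial (Fin 2) ℝ) ≤
      ((2 : ℝ) ^ (2 / p))⁻¹ := by
  refine Real.iSup_le ?_ (by positivity)
  rintro ⟨x, hx⟩
  rw [norm_piLp_fin_two_le_one_iff hp] at hx
  simp only [map_mul, MvPolynomial.eval_X]
  rw [← Real.rpow_le_rpow_iff (abs_nonneg _) (by positivity) hp, Real.inv_rpow (by positivity),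
    ← Real.rpow_mul (by norm_num), div_mul_cancel₀ _ hp.ne', abs_mul,
    Real.mul_rpow (abs_nonneg _) (abs_nonneg _)]
  have h₀ := Real.rpow_nonneg (abs_nonneg (x 0)) p
  have h₁ := Real.rpow_nonneg (abs_nonneg (x 1)) p
  norm_num
  -- AM-GM: `u + v ≤ 1` forces `uv ≤ 1/4`.
  nlinarith [sq_nonneg (|x 0| ^ p - |x 1| ^ p)]

theorem isOptimalHLConstant_two {p q : ℝ} (hp₀ : 0 < p) (hp₄ : p ≤ 4) (hq : 2 ≤ q) :
    IsOptimalHLConstant 2 p q ((2 : ℝ) ^ (2 / p)) := by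
  refine ⟨fun P hP => ?_, fun K hK => ?_⟩
  · refine coeffNorm_le_of_sum_sq_le hq (mul_nonneg (by positivity) (polyNorm_nonneg p P)) ?_
    refine sum_sq_le_of_form_le fun x y => ?_
    have h := two_mul_sq_eval_le hp₀ hp₄ hP ![x, y]
    rw [eval_eq_of_isHomogeneous_two hP] at h
    simpa using h
  · have h := hK (MvPolynomial.X 0 * MvPolynomial.X 1)
      ((MvPolynomial.isHomogeneous_X ℝ 0).mul (MvPolynomial.isHomogeneous_X ℝ 1))
    rw [coeffNorm_X_zero_mul_X_one (by linarith)] at h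
    have hle := polyNorm_X_zero_mul_X_one_le hp₀
    have hnn := polyNorm_nonneg p (MvPolynomial.X 0 * MvPolynomial.X 1 : MvPolynomial (Fin 2) ℝ)
    have hK₀ : 0 ≤ K := by
      by_contra! hneg
      linarith [mul_nonpos_of_nonpos_of_nonneg hneg.le hnn]
    have := h.trans (mul_le_mul_of_nonneg_left hle hK₀)
    rwa [← div_eq_mul_inv, one_le_div (by positivity)] at this

theorem theorem1 (p : ℝ) (hp₂ : 2 < p) (hp₄ : p ≤ 4) :
    IsOptimalHLConstant 2 p (p / (p - 2)) ((2 : ℝ) ^ (2 / p)) ∧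
    ∀ q : ℝ, 2 ≤ q → IsOptimalHLConstant 2 p q ((2 : ℝ) ^ (2 / p)) := by
  have hp₀ : 0 < p := by linarith
  refine ⟨isOptimalHLConstant_two hp₀ hp₄ ?_, fun q hq => isOptimalHLConstant_two hp₀ hp₄ hq⟩
  -- `2 ≤ p / (p - 2)` is equivalent to `p ≤ 4`.
  rw [le_div_iff₀ (by linarith)]
  linarith
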